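/- Setting. A control-flow graph is a directed multigraph with a finite non-empty set $F$ of nodes (flow-points), $|F|=m$, all reachable from an initial node; each flow-point $f$ has a set $\mathit{Var}(f)$ of exactly $n$ variables. A size-change graph $G:f\to g$ is a bipartite directed graph from $\mathit{Var}(f)$ to $\mathit{Var}(g)$, each arc being labelled strict or non-strict. An SCT instance $\mathcal G$ consists of a control-flow graph and a size-change graph $G_c:f\to g$ for each of its arcs $c$ from $f$ to $g$. It is strongly connected if every flow-point is reachable from every flow-point, and fan-in free if in every $G_c$ each target variable has in-degree at most $1$. It is positive if for every infinite directed path $c_0c_1c_2\dots$ in the control-flow graph, the layered graph obtained by concatenating $G_{c_0},G_{c_1},\dots$ contains an infinite directed path (beginning in any layer) with infinitely many strict arcs. Given a well-ordered set $\mathit{Val}$, a state is a pair $(f,\sigma)$ with $f\in F$ and $\sigma:\mathit{Var}(f)\to\mathit{Val}$. There is a transition from $(f,\sigma)$ to $(g,\sigma')$ if for some arc $c$ from $f$ to $g$, $\sigma(x)>\sigma'(y)$ for every strict arc $x\to y$ of $G_c$ and $\sigma(x)\ge\sigma'(y)$ for every non-strict arc $x\to y$ of $G_c$. A ranking function for $\mathcal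 G$ is a map $\rho$ from the states to a well-founded ordered set such that $\rho_f(\sigma)>\rho_g(\sigma')$ for every transition from $(f,\sigma)$ to $(g,\sigma')$, where $\rho_f(\sigma)=\rho(f,\sigma)$. For $B\in\mathbb N$, let $\widetilde V_f^B$ be the set of tuples $\langle\{x_1\},b_1,\{x_2\},b_2,\dots,\{x_n\},b_n\rangle$ in which $x_1,\dots,x_n$ lists every element of $\mathit{Var}(f)$ exactly once and each $b_i$ is an integer with $0\le b_i\le B$. The value of such a tuple in the store $\sigma$ is $(\sigma(x_1),b_1,\dots,\sigma(x_n),b_n)\in(\mathit{Val}\times\mathbb N)^n$. Values are ordered lexicographically, and for a non-empty finite $S\subseteq\widetilde V_f^B$, $\max_\sigma S$ denotes the largest of the values of its elements in $\sigma$. Statement. Let $\mathcal G$ be a strongly connected, fan-in free, positive SCT instance, and let $B=m\cdot 2^n\cdot n$. Then there are non-empty sets $S_f\subseteq\widetilde V_f^B$ ($f\in F$), depending only on $\mathcal G$, with $|S_f|\le n!$ for every $f$, such that for every well-ordered set $\mathit{Val}$ the function $\rho_f(\sigma)=\max_\sigma S_f$ is a ranking function for $\mathcal G$. -/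

import Mathlib

universe u v w x

namespace SCT

/-- The two labels of a size-change arc: `strict` (`↓`) and `nonstrict` (`↓` or equal). -/
inductive Label where
  | strict
  | nonstrict

/-- A size-change graph with source variables `X` and target variables `Y`: a bipartite directed
graph whose arcs carry a label. `label x y = none` means that there is no arc `x → y`. -/
structure SCGraph (X : Type*) (Y : Type*) where
  label : X → Y → Option Label

namespace SCGraph

variable {X Y : Type*}

/-- There is an arc `x → y`, however labelled. -/
def HasArc (G : SCGraph X Y) (a : X) (b : Y) : Prop := ∃ l, G.label a b = some l

/-- There is a strict arc `x → y`. -/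
def HasStrictArc (G : SCGraph X Y) (a : X) (b : Y) : Prop := G.label a b = some Label.strict

/-- There is a non-strict arc `x → y`. -/
def HasNonstrictArc (G : SCGraph X Y) (a : X) (b : Y) : Prop :=
  G.label a b = some Label.nonstrict

/-- `G ⊨ σ ↦ σ'`: the stores satisfy all the constraints that the arcs of `G` stand for. -/
def Describes {Val : Type*} [LinearOrder Val] (G : SCGraph X Y) (σ : X → Val) (σ' : Y → Val) :
    Prop :=
  (∀ a b, G.HasStrictArc a b → σ' b < σ a) ∧ (∀ a b, G.HasNonstrictArc a b → σ' b ≤ σ a)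

/-- All in-degrees are at most `1`. (Source nodes of a bipartite graph have in-degree `0`.) -/
def FanInFree (G : SCGraph X Y) : Prop := ∀ a a' b, G.HasArc a b → G.HasArc a' b → a = a'

end SCGraph

/-- An SCT instance (annotated control-flow graph) in which every flow-point has `n` variables:
a directed multigraph with finitely many nodes, all of them reachable from an initial node, a set
of variables for every node, and a size-change graph for every arc. -/
structure Instance (n : ℕ) where
  Point : Type u
  [fintypePoint : Fintype Point]
  Arc : Point → Point → Type v
  Var : Point → Type w
  [fintypeVar : ∀ f, Fintype (Var f)]
  card_var : ∀ f, Fintype.card (Var f) = n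
  init : Point
  reachable : ∀ f, Relation.ReflTransGen (fun a b => Nonempty (Arc a b)) init f
  graph : ∀ {f g : Point}, Arc f g → SCGraph (Var f) (Var g)

attribute [instance] Instance.fintypePoint Instance.fintypeVar

/-- An infinite multipath, given by an infinite directed path in the control-flow graph. -/
structure Multipath {n : ℕ} (I : Instance.{u, v, w} n) where
  point : ℕ → I.Point
  arc : ∀ i, I.Arc (point i) (point (i + 1))

/-- An infinite thread of an infinite multipath: an infinite directed path in its layered graph,
which may begin in any layer. -/
structure Multipath.Thread {n : ℕ} {I : Instance.{u, v, w} n} (M : Multipath I) where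
  start : ℕ
  var : ∀ i, I.Var (M.point (start + i))
  hasArc : ∀ i, (I.graph (M.arc (start + i))).HasArc (var i) (var (i + 1))

/-- The thread includes infinitely many strict arcs. -/
def Multipath.Thread.InfinitelyDescending {n : ℕ} {I : Instance.{u, v, w} n} {M : Multipath I}
    (τ : M.Thread) : Prop :=
  ∀ N, ∃ i, N ≤ i ∧ (I.graph (M.arc (τ.start + i))).HasStrictArc (τ.var i) (τ.var (i + 1))

namespace Instance

variable {n : ℕ} (I : Instance.{u, v, w} n)

/-- The number `m` of flow-points. -/
def numPoints : ℕ := Fintype.card I.Point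

/-- The SCT condition: every infinite multipath contains an infinitely descending thread. -/
def Positive : Prop := ∀ M : Multipath I, ∃ τ : M.Thread, τ.InfinitelyDescending

/-- Every size-change graph of the instance is fan-in free. -/
def FanInFree : Prop := ∀ (f g : I.Point) (c : I.Arc f g), (I.graph c).FanInFree

/-- Every flow-point is reachable from every flow-point. -/
def StronglyConnected : Prop :=
  ∀ f g, Relation.ReflTransGen (fun a b => Nonempty (I.Arc a b)) f g

/-- Abstract program states: a flow-point with a store for its variables. -/
abbrev State (Val : Type x) := Σ f : I.Point, (I.Var f → Val)

/-- The transition system of the instance. -/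
def Transition {Val : Type x} [LinearOrder Val] (s s' : I.State Val) : Prop :=
  ∃ c : I.Arc s.1 s'.1, (I.graph c).Describes s.2 s'.2

/-- A (global) ranking function: its codomain is well-founded and it descends on every
transition. -/
def IsRankingFunction {Val : Type x} [LinearOrder Val] {W : Type*} [Preorder W]
    (ρ : I.State Val → W) : Prop :=
  WellFounded (fun a b : W => a < b) ∧ ∀ s s', I.Transition s s' → ρ s' < ρ s

end Instance

/-- The simple vectors over a set `X` of `n` variables, with numbers bounded by `B`: tuples
`⟨{x₁}, b₁, {x₂}, b₂, …⟩` of even length, where the singletons `{xᵢ}` form a partition of `X`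
(so `x₁, x₂, …` lists every variable exactly once, and there are `n` of them) and every `bᵢ` is
an integer between `0` and `B`. -/
structure SimpleVector (X : Type*) (n B : ℕ) where
  var : Fin n ≃ X
  num : Fin n → ℕ
  num_le : ∀ i, num i ≤ B

/-- The value of a simple vector in a store, an element of `(Val × ℕ)ⁿ` under the lexicographic
order. -/
def SimpleVector.value {X : Type*} {n B : ℕ} {Val : Type*} (a : SimpleVector X n B)
    (σ : X → Val) : Lex (Fin n → Lex (Val × ℕ)) :=
  toLex fun i => toLex (σ (a.var i), a.num i)

/-- `max` of the values of the vectors in the non-empty finite set `S`, in the store `σ`. -/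
noncomputable def maxVal {X : Type*} {n B : ℕ} {Val : Type*} [LinearOrder Val]
    (S : Finset (SimpleVector X n B)) (hS : S.Nonempty) (σ : X → Val) :
    Lex (Fin n → Lex (Val × ℕ)) :=
  S.sup' hS fun a => a.value σ

end SCT

/-!
Freeze some variables at a flow-point and let an arc lead to another flow-point with frozen
variables when each of the latter is the target of a non-strict arc from one of the former. A
variable at a node of this finite graph *persists* if it can be traced back, through unfrozen
variables, along all walks inside the strongly connected component of the node. As long as some
variable is unfrozen, one persists: otherwise every unfrozen variable is cut off by some walk in the
component, and by fan-in freeness these walks combine into a single closed walk that cuts off all of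
them. Repeated forever, it gives a multipath on which no thread descends infinitely.

The vectors of `S_f` list the variables of `f` so that each of them persists once the preceding ones
are frozen, and `b_i` counts the nodes reachable when the first `i` are frozen. Along a transition
from `f` to `g`, a vector of `S_g` is matched backwards by one of `S_f`: the next variable persists,
so it has a persistent source. The first strict arc, or the first step out of a component, makes the
value drop. One of the two occurs, since otherwise all variables would be carried by non-strict arcs
around a closed walk.
-/

namespace SCT

open Relation Filter

section Sequences

variable {α : Type*} {r : α → α → Prop}

theorem exists_seq_of_transGen_self {a : α} (h : TransGen r a a) :
    ∃ s : ℕ → α, (∀ i, r (s i) (s (i + 1))) ∧ ∃ᶠ i in atTop, s i = a := by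
  obtain ⟨b, hab, hba⟩ := TransGen.head'_iff.1 h
  obtain ⟨l, hchain, hlast⟩ := List.exists_isChain_cons_of_relationReflTransGen hba
  have hmod (i : ℕ) : i % (l.length + 1) < (b :: l).length := Nat.mod_lt _ l.length.succ_pos
  refine ⟨fun i => (b :: l)[i % (l.length + 1)]'(hmod i), fun i => ?_, ?_⟩
  · rcases (Nat.lt_succ_iff.1 (hmod i)).lt_or_eq with hi | hi
    · have hsucc : (i + 1) % (l.length + 1) = i % (l.length + 1) + 1 := by
        rw [← Nat.mod_add_mod, Nat.mod_eq_of_lt (by omega)]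
      simpa only [hsucc] using hchain.getElem (i % (l.length + 1)) (by simpa using hi)
    · have hzero : (i + 1) % (l.length + 1) = 0 := by rw [← Nat.mod_add_mod, hi, Nat.mod_self]
      simpa [hi, hzero, ← hlast, List.getLast_eq_getElem] using hab
  · refine (Nat.frequently_mod_eq l.length.lt_succ_self).mono fun i hi => ?_
    simpa [hi, List.getLast_eq_getElem] using hlast

/-- The relation `r` in which the steps out of `b` are replaced by the steps out of `a`. -/
def Restart (r : α → α → Prop) (a b s t : α) : Prop :=
  (s = b → r a t) ∧ (s ≠ b → r s t)

theorem transGen_restart {a b : α} (h : TransGen r a b) : TransGen (Restart r a b) b b := by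
  suffices H : ∀ s, TransGen r s b → ∃ t, r s t ∧ ReflTransGen (Restart r a b) t b by
    obtain ⟨t, hat, htb⟩ := H a h
    exact TransGen.head' ⟨fun _ => hat, fun hb => absurd rfl hb⟩ htb
  intro s hs
  induction hs using TransGen.head_induction_on with
  | single hsb => exact ⟨b, hsb, .refl⟩
  | @head s c hsc _ ih =>
    obtain ⟨t, hct, htb⟩ := ih
    refine ⟨c, hsc, ?_⟩
    by_cases hc : c = b
    · rw [hc]
    · exact .head ⟨fun h => absurd h hc, fun _ => hct⟩ htb

end Sequences

section ReachCard

variable {α : Type*} [Finite α] {r : α → α → Prop} {a b : α}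

/-- The number of elements reachable from `a` along `r`. It is constant on the strongly connected
components of `r` and drops from one component to the next. -/
noncomputable def reachCard (r : α → α → Prop) (a : α) : ℕ := {b | ReflTransGen r a b}.ncard

theorem reachCard_le_of_reach (h : ReflTransGen r a b) : reachCard r b ≤ reachCard r a :=
  Set.ncard_le_ncard fun _ hb => h.trans hb

theorem reachCard_lt_of_reach (h : ReflTransGen r a b) (h' : ¬ ReflTransGen r b a) :
    reachCard r b < reachCard r a :=
  Set.ncard_lt_ncard ⟨fun _ hb => h.trans hb, fun hs => h' (hs .refl)⟩

end ReachCard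

theorem toLex_lt_toLex_of_le_of_lt {ι : Type*} {β : ι → Type*} [LinearOrder ι] [WellFoundedLT ι]
    [∀ i, PartialOrder (β i)] {a b : ∀ i, β i} (i : ι) (hle : ∀ j < i, a j ≤ b j)
    (hlt : a i < b i) : toLex a < toLex b := by
  obtain ⟨j, hj, hmin⟩ := WellFounded.has_min (wellFounded_lt (α := ι)) {j | a j < b j} ⟨i, hlt⟩
  have hji : j ≤ i := not_lt.1 (hmin i hlt)
  exact ⟨j, fun l hl => (hle l (hl.trans_le hji)).eq_of_not_lt fun h => hmin l h hl, hj⟩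

namespace Instance

variable {n : ℕ} {I : Instance.{u, v, w} n} {f g : I.Point} {c : I.Arc f g}

section Frozen

/-- A flow-point with a set of its variables, called frozen. Counting the frozen points reachable
from one gives the numbers in the vectors. -/
abbrev FrozenPoint (I : Instance.{u, v, w} n) := Σ f : I.Point, Set (I.Var f)

/-- Every variable of `Y` is the target of a non-strict arc of `G_c` from a variable of `X`. -/
def Carries (c : I.Arc f g) (X : Set (I.Var f)) (Y : Set (I.Var g)) : Prop :=
  ∀ y ∈ Y, ∃ x ∈ X, (I.graph c).HasNonstrictArc x y

/-- The arcs between frozen points: arcs of the control-flow graph that carry the frozen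
variables. -/
def FrozenStep (I : Instance.{u, v, w} n) (p q : I.FrozenPoint) : Prop :=
  ∃ c : I.Arc p.1 q.1, Carries c p.2 q.2

/-- Reachability between frozen points. -/
abbrev FrozenReach (I : Instance.{u, v, w} n) : I.FrozenPoint → I.FrozenPoint → Prop :=
  ReflTransGen I.FrozenStep

theorem card_frozenPoint : Nat.card I.FrozenPoint = I.numPoints * 2 ^ n := by
  classical
  rw [Nat.card_sigma]
  simp [numPoints, I.card_var]

theorem reachCard_frozenStep_le (p : I.FrozenPoint) :
    reachCard I.FrozenStep p ≤ I.numPoints * 2 ^ n :=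
  card_frozenPoint (I := I) ▸ Set.ncard_le_card _

theorem frozenReach_empty (hconn : I.StronglyConnected) (f g : I.Point) :
    I.FrozenReach ⟨f, ∅⟩ ⟨g, ∅⟩ :=
  ReflTransGen.lift (p := I.FrozenStep) (fun f => ⟨f, ∅⟩)
    (fun _ _ ⟨c⟩ => ⟨c, fun _ hy => absurd hy (Set.notMem_empty _)⟩) f g (hconn f g)

theorem frozenStep_image {ι : Type*} {x : ι → I.Var f} {y : ι → I.Var g} {T : Set ι}
    (h : ∀ i ∈ T, (I.graph c).HasNonstrictArc (x i) (y i)) :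
    I.FrozenStep ⟨f, x '' T⟩ ⟨g, y '' T⟩ :=
  ⟨c, Set.forall_mem_image.2 fun i hi => ⟨x i, Set.mem_image_of_mem x hi, h i hi⟩⟩

theorem Carries.mem_and_not_hasStrictArc (hfan : I.FanInFree) {X : Set (I.Var f)}
    {Y : Set (I.Var g)} (hc : Carries c X Y) {x : I.Var f} {y : I.Var g}
    (hxy : (I.graph c).HasArc x y) (hy : y ∈ Y) : x ∈ X ∧ ¬ (I.graph c).HasStrictArc x y := by
  obtain ⟨x', hx', hxy'⟩ := hc y hy
  obtain rfl : x' = x := hfan _ _ c _ _ _ ⟨_, hxy'⟩ hxy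
  exact ⟨hx', fun hst => by simpa using hst.symm.trans hxy'⟩

theorem notMem_of_hasStrictArc (hfan : I.FanInFree) {M : Multipath I}
    {X : ∀ i, Set (I.Var (M.point i))} (hX : ∀ i, Carries (M.arc i) (X i) (X (i + 1)))
    (τ : M.Thread) {j : ℕ}
    (hst : (I.graph (M.arc (τ.start + j))).HasStrictArc (τ.var j) (τ.var (j + 1))) {i : ℕ}
    (hji : j < i) : τ.var i ∉ X (τ.start + i) := by
  induction i, hji using Nat.le_induction with
  | base => exact fun hmem => ((hX _).mem_and_not_hasStrictArc hfan (τ.hasArc j) hmem).2 hst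
  | succ i _ ih => exact fun hmem => ih ((hX _).mem_and_not_hasStrictArc hfan (τ.hasArc i) hmem).1

end Frozen

section Tracing

/-- The variables with an arc of `G_c` into the set `K`. -/
def sources (c : I.Arc f g) (K : Set (I.Var g)) : Set (I.Var f) :=
  {x | ∃ y ∈ K, (I.graph c).HasArc x y}

/-- A frozen point with a set of further variables, which are being traced backwards. -/
abbrev TracedPoint (I : Instance.{u, v, w} n) := Σ p : I.FrozenPoint, Set (I.Var p.1)

/-- A step between frozen points along which the sources of the traced variables are frozen or
traced. -/
def TraceStep (I : Instance.{u, v, w} n) (s t : I.TracedPoint) : Prop :=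
  ∃ c : I.Arc s.1.1 t.1.1, Carries c s.1.2 t.1.2 ∧ sources c t.2 ⊆ s.1.2 ∪ s.2

/-- `TraceReach ⟨p, L⟩ ⟨q, K⟩` says that along some walk from `p` to `q` every thread into `K`
starts late, starts in `L` or visits a frozen variable. -/
abbrev TraceReach (I : Instance.{u, v, w} n) : I.TracedPoint → I.TracedPoint → Prop :=
  ReflTransGen I.TraceStep

theorem sources_empty (c : I.Arc f g) : sources c ∅ = ∅ := by
  simp [sources]

theorem mem_sources_singleton {x : I.Var f} {y : I.Var g} :
    x ∈ sources c {y} ↔ (I.graph c).HasArc x y := by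
  simp [sources]

theorem ncard_sources_le (hfan : I.FanInFree) (c : I.Arc f g) (K : Set (I.Var g)) :
    (sources c K).ncard ≤ K.ncard := by
  have hK : ∀ x : sources c K, ∃ y : K, (I.graph c).HasArc x y := by simp [sources]
  choose target harc using hK
  exact Nat.card_le_card_of_injective target fun x x' h =>
    Subtype.ext (hfan _ _ c _ _ _ (harc x) (h ▸ harc x'))

theorem traceReach_empty {p q : I.FrozenPoint} (h : I.FrozenReach p q) :
    I.TraceReach ⟨p, ∅⟩ ⟨q, ∅⟩ :=
  ReflTransGen.lift (p := I.TraceStep) (fun p => ⟨p, ∅⟩)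
    (fun _ _ ⟨c, hc⟩ => ⟨c, hc, by simp [sources_empty]⟩) p q h

theorem exists_traceReach_union (hfan : I.FanInFree) {s t : I.TracedPoint} (h : I.TraceReach s t)
    {K : Set (I.Var t.1.1)} (hK : K ⊆ t.1.2ᶜ) :
    ∃ L ⊆ s.1.2ᶜ, L.ncard ≤ K.ncard ∧ I.TraceReach ⟨s.1, s.2 ∪ L⟩ ⟨t.1, t.2 ∪ K⟩ := by
  induction h using ReflTransGen.head_induction_on with
  | refl => exact ⟨K, hK, le_rfl, .refl⟩
  | @head s s' hstep _ ih =>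
    obtain ⟨L, -, hcard, hreach⟩ := ih
    obtain ⟨c, hc, hsrc⟩ := hstep
    refine ⟨sources c L \ s.1.2, fun _ hx => hx.2, ?_, ReflTransGen.head (b := ⟨s'.1, s'.2 ∪ L⟩)
      ⟨c, hc, ?_⟩ hreach⟩
    · exact (Set.ncard_le_ncard Set.sdiff_subset).trans ((ncard_sources_le hfan c L).trans hcard)
    · rintro x ⟨y, hy | hy, hxy⟩
      · exact (hsrc ⟨y, hy, hxy⟩).imp_right Or.inl
      · by_cases hx : x ∈ s.1.2
        · exact Or.inl hx
        · exact Or.inr (Or.inr ⟨⟨y, hy, hxy⟩, hx⟩)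

theorem exists_traceReach (hfan : I.FanInFree) {p q : I.FrozenPoint}
    (h : I.FrozenReach p q) {K : Set (I.Var q.1)} (hK : K ⊆ q.2ᶜ) :
    ∃ L ⊆ p.2ᶜ, L.ncard ≤ K.ncard ∧ I.TraceReach ⟨p, L⟩ ⟨q, K⟩ := by
  simpa only [Set.empty_union] using exists_traceReach_union hfan (traceReach_empty h) hK

/-- In the Miyano–Hayashi style: a thread that never freezes again is untraced ever after it has
passed an index of `A`, although at the indices of `A` everything is frozen or traced. -/
theorem not_infinitelyDescending (hfan : I.FanInFree) {M : Multipath I}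
    {X K : ∀ i, Set (I.Var (M.point i))} {A : Set ℕ}
    (hX : ∀ i, Carries (M.arc i) (X i) (X (i + 1)))
    (hA : ∃ᶠ i in atTop, i ∈ A) (hall : ∀ i ∈ A, (X i)ᶜ ⊆ K i)
    (hrestart : ∀ i ∈ A, sources (M.arc i) (K (i + 1)) ⊆ X i)
    (hstep : ∀ i ∉ A, sources (M.arc i) (K (i + 1)) ⊆ X i ∪ K i) (τ : M.Thread) :
    ¬ τ.InfinitelyDescending := by
  intro hτ
  obtain ⟨j, -, hst⟩ := hτ 0
  have hfree : ∀ i > j, τ.var i ∉ X (τ.start + i) := fun i =>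
    notMem_of_hasStrictArc hfan hX τ hst
  have hvisit (k : ℕ) : ∃ i > k, τ.start + i ∈ A := by
    obtain ⟨l, hl, hlA⟩ := frequently_atTop.1 hA (τ.start + (k + 1))
    obtain ⟨d, rfl⟩ := Nat.exists_eq_add_of_le hl
    exact ⟨k + 1 + d, by omega, by rwa [← Nat.add_assoc]⟩
  obtain ⟨a, haj, ha⟩ := hvisit j
  have huntraced : ∀ i > a, τ.var i ∉ K (τ.start + i) := by
    intro i hi
    induction i, hi using Nat.le_induction with
    | base => exact fun hmem => hfree a haj (hrestart _ ha ⟨_, hmem, τ.hasArc a⟩)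
    | succ i hi ih =>
      intro hmem
      have hsource : τ.var i ∈ sources (M.arc (τ.start + i)) (K (τ.start + (i + 1))) :=
        ⟨_, hmem, τ.hasArc i⟩
      by_cases hiA : τ.start + i ∈ A
      · exact hfree i (by omega) (hrestart _ hiA hsource)
      · exact (hstep _ hiA hsource).elim (hfree i (by omega)) ih
  obtain ⟨b, hba, hb⟩ := hvisit a
  exact huntraced b hba (hall _ hb (hfree b (haj.trans hba)))

theorem not_transGen_traceStep (hfan : I.FanInFree) (hpos : I.Positive) (p : I.FrozenPoint) :
    ¬ TransGen I.TraceStep ⟨p, ∅⟩ ⟨p, p.2ᶜ⟩ := by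
  intro h
  obtain ⟨s, hs, hfreq⟩ := exists_seq_of_transGen_self (transGen_restart h)
  have hstep (i : ℕ) : ∃ c : I.Arc (s i).1.1 (s (i + 1)).1.1, Carries c (s i).1.2 (s (i + 1)).1.2 ∧
      (s i = ⟨p, p.2ᶜ⟩ → sources c (s (i + 1)).2 ⊆ (s i).1.2) ∧
      (s i ≠ ⟨p, p.2ᶜ⟩ → sources c (s (i + 1)).2 ⊆ (s i).1.2 ∪ (s i).2) := by
    by_cases hi : s i = ⟨p, p.2ᶜ⟩
    · obtain ⟨c, hc, hsrc⟩ := (hs i).1 hi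
      rw [hi]
      exact ⟨c, hc, fun _ => by simpa using hsrc, fun h => absurd rfl h⟩
    · obtain ⟨c, hc, hsrc⟩ := (hs i).2 hi
      exact ⟨c, hc, fun h => absurd h hi, fun _ => hsrc⟩
  choose c hc hrestart hmid using hstep
  let M : Multipath I := ⟨fun i => (s i).1.1, c⟩
  obtain ⟨τ, hτ⟩ := hpos M
  have hall : ∀ i, s i = ⟨p, p.2ᶜ⟩ → (s i).1.2ᶜ ⊆ (s i).2 := fun i hi => hi ▸ subset_rfl
  exact not_infinitelyDescending hfan (M := M) (X := fun i => (s i).1.2) (K := fun i => (s i).2)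
    (A := {i | s i = ⟨p, p.2ᶜ⟩}) hc hfreq hall hrestart hmid τ hτ

end Tracing

section Persistence

/-- Along some walk to `q` in the component of `q`, every thread into `K` visits a frozen variable
or starts late. -/
def Cut (q : I.FrozenPoint) (K : Set (I.Var q.1)) : Prop :=
  ∃ p, I.FrozenReach q p ∧ I.TraceReach ⟨p, ∅⟩ ⟨q, K⟩

/-- The variable `y` can be traced back, through variables that are not frozen, along all walks to
`q` in the component of `q`. -/
def Persists (q : I.FrozenPoint) (y : I.Var q.1) : Prop := y ∉ q.2 ∧ ¬ Cut q {y}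

theorem Persists.exists_source (hfan : I.FanInFree) {p q : I.FrozenPoint} {y : I.Var q.1}
    (hy : Persists q y) {c : I.Arc p.1 q.1} (hc : Carries c p.2 q.2) (hqp : I.FrozenReach q p) :
    ∃ x, (I.graph c).HasArc x y ∧ Persists p x := by
  have hsrc : ¬ sources c {y} ⊆ p.2 := fun hsub =>
    hy.2 ⟨p, hqp, .single ⟨c, hc, hsub.trans Set.subset_union_left⟩⟩
  obtain ⟨x, hxy, hxp⟩ := Set.not_subset.1 hsrc
  rw [mem_sources_singleton] at hxy
  refine ⟨x, hxy, hxp, fun ⟨r, hpr, hrp⟩ => hy.2 ⟨r, hqp.trans hpr, hrp.tail ⟨c, hc, ?_⟩⟩⟩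
  exact fun x' hxy' => Or.inr (hfan _ _ c _ _ _ (mem_sources_singleton.1 hxy') hxy)

theorem cut_of_forall_cut_singleton (hfan : I.FanInFree) {p : I.FrozenPoint}
    (h : ∀ y ∉ p.2, Cut p {y}) {K : Set (I.Var p.1)} (hK : K ⊆ p.2ᶜ) : Cut p K := by
  induction hn : K.ncard using Nat.strong_induction_on generalizing K with
  | _ k ih =>
    rcases K.eq_empty_or_nonempty with rfl | ⟨y, hy⟩
    · exact ⟨p, .refl, .refl⟩
    obtain ⟨q, hpq, hqp⟩ := h y (hK hy)
    obtain ⟨L, hLq, hLcard, hLK⟩ :=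
      exists_traceReach_union hfan hqp (K := K \ {y}) (Set.sdiff_subset.trans hK)
    obtain ⟨L', hL'p, hL'card, hL'L⟩ := exists_traceReach hfan hpq hLq
    have hlt : L'.ncard < k :=
      (hL'card.trans hLcard).trans_lt (hn ▸ Set.ncard_sdiff_singleton_lt_of_mem hy)
    obtain ⟨r, hpr, hrp⟩ := ih _ hlt hL'p rfl
    rw [Set.empty_union, Set.singleton_union, Set.insert_sdiff_singleton, Set.insert_eq_of_mem hy]
      at hLK
    exact ⟨r, hpr, hrp.trans (hL'L.trans hLK)⟩

theorem exists_persists (hfan : I.FanInFree) (hpos : I.Positive) {p : I.FrozenPoint}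
    (hp : p.2 ≠ Set.univ) : ∃ y, Persists p y := by
  by_contra! h
  obtain ⟨q, hpq, hqp⟩ := cut_of_forall_cut_singleton hfan
    (fun y hy => not_not.1 fun hcut => h y ⟨hy, hcut⟩) (subset_refl p.2ᶜ)
  rcases reflTransGen_iff_eq_or_transGen.1 ((traceReach_empty hpq).trans hqp) with heq | hclosed
  · rw [Sigma.mk.injEq, heq_eq_eq] at heq
    exact hp (Set.compl_empty_iff.1 heq.2)
  · exact not_transGen_traceStep hfan hpos p hclosed

theorem not_frozenReach_univ (hfan : I.FanInFree) (hpos : I.Positive)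
    (h : I.FrozenStep ⟨f, Set.univ⟩ ⟨g, Set.univ⟩) :
    ¬ I.FrozenReach ⟨g, Set.univ⟩ ⟨f, Set.univ⟩ := by
  intro hback
  obtain ⟨c, hc⟩ := h
  refine not_transGen_traceStep hfan hpos ⟨g, Set.univ⟩ (.tail' (traceReach_empty hback) ?_)
  exact ⟨c, hc, by simp⟩

end Persistence

section Vectors

/-- The first `k` variables of `x` persist, each of them when the preceding ones are frozen. -/
def PersistsUpTo (x : Fin n → I.Var f) (k : ℕ) : Prop :=
  ∀ i : Fin n, i.val < k → Persists ⟨f, x '' Set.Iio i⟩ (x i)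

theorem persistsUpTo_zero (x : Fin n → I.Var f) : PersistsUpTo x 0 :=
  fun _ hi => absurd hi (Nat.not_lt_zero _)

theorem PersistsUpTo.bijective {x : Fin n → I.Var f} (hx : PersistsUpTo x n) :
    Function.Bijective x := by
  refine (Fintype.bijective_iff_injective_and_card x).2 ⟨?_, by simp [I.card_var]⟩
  exact .of_lt_imp_ne fun i j hij heq => (hx j j.2).1 ⟨i, hij, heq⟩

theorem PersistsUpTo.update {x : Fin n → I.Var f} {i : Fin n} (hx : PersistsUpTo x i)
    {z : I.Var f} (hz : Persists ⟨f, x '' Set.Iio i⟩ z) :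
    PersistsUpTo (Function.update x i z) (i + 1) := by
  intro j hj
  have hji : j ≤ i := Nat.lt_succ_iff.1 hj
  have himage : Function.update x i z '' Set.Iio j = x '' Set.Iio j :=
    Set.image_congr fun l hl => Function.update_of_ne (hl.trans_le hji).ne z x
  rw [himage]
  rcases hji.lt_or_eq with hlt | rfl
  · rw [Function.update_of_ne hlt.ne]
    exact hx j hlt
  · rwa [Function.update_self]

theorem PersistsUpTo.exists_extension (hfan : I.FanInFree) (hpos : I.Positive) {k : ℕ}
    (hk : k ≤ n) {x : Fin n → I.Var f} (hx : PersistsUpTo x k) :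
    ∃ x' : Fin n → I.Var f, PersistsUpTo x' n ∧ ∀ i : Fin n, i.val < k → x' i = x i := by
  suffices H : ∀ m ≥ k, m ≤ n → ∃ x' : Fin n → I.Var f,
      PersistsUpTo x' m ∧ ∀ i : Fin n, i.val < k → x' i = x i from H n hk le_rfl
  intro m hm
  induction m, hm using Nat.le_induction with
  | base => exact fun _ => ⟨x, hx, fun _ _ => rfl⟩
  | succ m hkm ih =>
    intro hmn
    obtain ⟨x', hx', hagree⟩ := ih (Nat.le_of_succ_le hmn)
    let i : Fin n := ⟨m, hmn⟩
    have hne : x' '' Set.Iio i ≠ Set.univ := by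
      intro huniv
      have hcard : (x' '' Set.Iio i).ncard ≤ (Set.Iio i).ncard := Set.ncard_image_le
      rw [huniv, Set.ncard_univ, Nat.card_eq_fintype_card, I.card_var, ← Finset.coe_Iio,
        Set.ncard_coe_finset, Fin.card_Iio] at hcard
      exact absurd hmn (not_lt.2 hcard)
    obtain ⟨z, hz⟩ := exists_persists hfan hpos (p := ⟨f, x' '' Set.Iio i⟩) hne
    refine ⟨Function.update x' i z, PersistsUpTo.update (i := i) hx' hz, fun j hj => ?_⟩
    rw [Function.update_of_ne (Fin.ne_of_val_ne (hj.trans_le hkm).ne), hagree j hj]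

theorem exists_persistsUpTo (hfan : I.FanInFree) (hpos : I.Positive) (f : I.Point) :
    ∃ x : Fin n → I.Var f, PersistsUpTo x n := by
  let e := (Fintype.equivFinOfCardEq (I.card_var f)).symm
  obtain ⟨x, hx, -⟩ := (persistsUpTo_zero e).exists_extension hfan hpos n.zero_le
  exact ⟨x, hx⟩

theorem PersistsUpTo.exists_replacement (hfan : I.FanInFree) (hpos : I.Positive)
    {x : Fin n → I.Var f} (hx : PersistsUpTo x n) {i : Fin n} {z : I.Var f}
    (hz : Persists ⟨f, x '' Set.Iio i⟩ z) :
    ∃ x' : Fin n → I.Var f, PersistsUpTo x' n ∧ (∀ j < i, x' j = x j) ∧ x' i = z := by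
  have hxi : PersistsUpTo x i := fun j hj => hx j (hj.trans i.2)
  obtain ⟨x', hx', hagree⟩ := (hxi.update hz).exists_extension hfan hpos i.2
  refine ⟨x', hx', fun j hj => ?_, ?_⟩
  · rw [hagree j (Nat.lt_succ_of_lt hj), Function.update_of_ne hj.ne]
  · rw [hagree i i.val.lt_succ_self, Function.update_self]

/-- The number that follows the `i`-th variable of `x` in the vector: the number of frozen points
reachable when the variables up to the `i`-th are frozen. -/
noncomputable def rankAt (x : Fin n → I.Var f) (i : Fin n) : ℕ :=
  reachCard I.FrozenStep ⟨f, x '' Set.Iic i⟩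

theorem rankAt_le (x : Fin n → I.Var f) (i : Fin n) :
    rankAt x i ≤ I.numPoints * 2 ^ n * n :=
  (reachCard_frozenStep_le _).trans (Nat.le_mul_of_pos_right _ (Fin.pos i))

/-- The simple vector of a persistent listing of the variables. -/
noncomputable def PersistsUpTo.toVector {x : Fin n → I.Var f}
    (hx : PersistsUpTo x n) : SimpleVector (I.Var f) n (I.numPoints * 2 ^ n * n) where
  var := .ofBijective x hx.bijective
  num := rankAt x
  num_le := rankAt_le x

theorem PersistsUpTo.value_lt_value {Val : Type*} [PartialOrder Val]
    {σ : I.Var f → Val} {σ' : I.Var g → Val} {x : Fin n → I.Var f} {y : Fin n → I.Var g}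
    (hx : PersistsUpTo x n) (hy : PersistsUpTo y n) (i : Fin n)
    (hle : ∀ j < i, σ' (y j) ≤ σ (x j) ∧ rankAt y j ≤ rankAt x j)
    (hlt : σ' (y i) < σ (x i) ∨ σ' (y i) ≤ σ (x i) ∧ rankAt y i < rankAt x i) :
    hy.toVector.value σ' < hx.toVector.value σ := by
  refine toLex_lt_toLex_of_le_of_lt i (fun j hj => Prod.Lex.toLex_mono (hle j hj)) ?_
  rcases hlt with hlt | ⟨hval, hrank⟩
  · exact Prod.Lex.toLex_lt_toLex'.2 ⟨hlt.le, fun heq => absurd heq hlt.ne⟩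
  · exact Prod.Lex.toLex_lt_toLex'.2 ⟨hval, fun _ => hrank⟩

/-- Along the arc `c`, the first `k` variables of `y` come from those of `x` by non-strict arcs,
without leaving the component of frozen points. -/
structure Shadows (c : I.Arc f g) (x : Fin n → I.Var f) (y : Fin n → I.Var g)
    (k : ℕ) : Prop where
  arc : ∀ i : Fin n, i.val < k → (I.graph c).HasNonstrictArc (x i) (y i)
  back : I.FrozenReach ⟨g, y '' {i | i.val < k}⟩ ⟨f, x '' {i | i.val < k}⟩

theorem shadows_zero (hconn : I.StronglyConnected) (c : I.Arc f g)
    (x : Fin n → I.Var f) (y : Fin n → I.Var g) : Shadows c x y 0 where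
  arc _ hi := absurd hi (Nat.not_lt_zero _)
  back := by simpa using frozenReach_empty hconn g f

theorem not_shadows (hfan : I.FanInFree) (hpos : I.Positive)
    {x : Fin n → I.Var f} {y : Fin n → I.Var g} (hx : Function.Surjective x)
    (hy : Function.Surjective y) : ¬ Shadows c x y n := by
  rintro ⟨harc, hback⟩
  have hstep := frozenStep_image (T := Set.univ) fun i _ => harc i i.2
  have huniv : {i : Fin n | i.val < n} = Set.univ := Set.eq_univ_of_forall fun i => i.2
  simp only [huniv, Set.image_univ, hx.range_eq, hy.range_eq] at hstep hback
  exact not_frozenReach_univ hfan hpos hstep hback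

theorem Shadows.exists_succ_or_value_lt (hfan : I.FanInFree) (hpos : I.Positive)
    {Val : Type*} [LinearOrder Val] {σ : I.Var f → Val}
    {σ' : I.Var g → Val} (hσ : (I.graph c).Describes σ σ') {x : Fin n → I.Var f}
    (hx : PersistsUpTo x n) {y : Fin n → I.Var g} (hy : PersistsUpTo y n) {i : Fin n}
    (h : Shadows c x y i) :
    ∃ (x' : Fin n → I.Var f) (hx' : PersistsUpTo x' n),
      Shadows c x' y (i + 1) ∨ hy.toVector.value σ' < hx'.toVector.value σ := by
  obtain ⟨z, ⟨l, hl⟩, hz⟩ := (hy i i.2).exists_source (p := ⟨f, x '' Set.Iio i⟩) hfan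
    (Set.forall_mem_image.2 fun j hj => ⟨x j, Set.mem_image_of_mem x hj, h.arc j hj⟩) h.back
  obtain ⟨x', hx', hagree, rfl⟩ := hx.exists_replacement hfan hpos hz
  have harc : ∀ j < i, (I.graph c).HasNonstrictArc (x' j) (y j) := fun j hj =>
    hagree j hj ▸ h.arc j hj
  have hle : ∀ j < i, σ' (y j) ≤ σ (x' j) ∧ rankAt y j ≤ rankAt x' j := fun j hj =>
    ⟨hσ.2 _ _ (harc j hj),
      reachCard_le_of_reach (.single (frozenStep_image fun k hk => harc k (hk.trans_lt hj)))⟩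
  refine ⟨x', hx', ?_⟩
  cases l with
  | strict => exact Or.inr (hx'.value_lt_value hy i hle (Or.inl (hσ.1 _ _ hl)))
  | nonstrict =>
    have harc' : ∀ j ≤ i, (I.graph c).HasNonstrictArc (x' j) (y j) := fun j hj =>
      hj.lt_or_eq.elim (harc j) fun hji => hji ▸ hl
    by_cases hback : I.FrozenReach ⟨g, y '' Set.Iic i⟩ ⟨f, x' '' Set.Iic i⟩
    · have hIic : {j : Fin n | j.val < i.val + 1} = Set.Iic i := Set.ext fun j => Nat.lt_succ_iff
      exact Or.inl ⟨fun j hj => harc' j (Nat.lt_succ_iff.1 hj), hIic ▸ hback⟩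
    · have hrank : rankAt y i < rankAt x' i :=
        reachCard_lt_of_reach (.single (frozenStep_image harc')) hback
      exact Or.inr (hx'.value_lt_value hy i hle (Or.inr ⟨hσ.2 _ _ hl, hrank⟩))

theorem PersistsUpTo.exists_value_lt (hconn : I.StronglyConnected) (hfan : I.FanInFree)
    (hpos : I.Positive) {Val : Type*} [LinearOrder Val]
    {σ : I.Var f → Val} {σ' : I.Var g → Val} (hσ : (I.graph c).Describes σ σ')
    {y : Fin n → I.Var g} (hy : PersistsUpTo y n) :
    ∃ (x : Fin n → I.Var f) (hx : PersistsUpTo x n),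
      hy.toVector.value σ' < hx.toVector.value σ := by
  by_contra! hno
  have hshadow : ∀ k ≤ n, ∃ x : Fin n → I.Var f, PersistsUpTo x n ∧ Shadows c x y k := by
    intro k
    induction k with
    | zero =>
      obtain ⟨x, hx⟩ := exists_persistsUpTo hfan hpos f
      exact fun _ => ⟨x, hx, shadows_zero hconn c x y⟩
    | succ k ih =>
      intro hk
      obtain ⟨x, hx, h⟩ := ih (Nat.le_of_succ_le hk)
      obtain ⟨x', hx', h' | hlt⟩ := h.exists_succ_or_value_lt (i := ⟨k, hk⟩) hfan hpos hσ hx hy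
      · exact ⟨x', hx', h'⟩
      · exact (hno x' hx' hlt).elim
  obtain ⟨x, hx, h⟩ := hshadow n le_rfl
  exact not_shadows hfan hpos hx.bijective.surjective hy.bijective.surjective h

open Classical in
/-- The sets `S_f` of the theorem: the vectors of all persistent listings of the variables. -/
noncomputable def persistentVectors (I : Instance.{u, v, w} n) (f : I.Point) :
    Finset (SimpleVector (I.Var f) n (I.numPoints * 2 ^ n * n)) :=
  Finset.univ.image fun x : {x : Fin n → I.Var f // PersistsUpTo x n} => x.2.toVector

theorem PersistsUpTo.toVector_mem {x : Fin n → I.Var f} (hx : PersistsUpTo x n) :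
    hx.toVector ∈ I.persistentVectors f := by
  classical exact Finset.mem_image.2 ⟨⟨x, hx⟩, Finset.mem_univ _, rfl⟩

theorem persistentVectors_nonempty (hfan : I.FanInFree) (hpos : I.Positive) (f : I.Point) :
    (I.persistentVectors f).Nonempty := by
  obtain ⟨_, hx⟩ := exists_persistsUpTo hfan hpos f
  exact ⟨_, hx.toVector_mem⟩

theorem card_persistentVectors_le (f : I.Point) : (I.persistentVectors f).card ≤ n.factorial := by
  classical
  let toEquiv (x : {x : Fin n → I.Var f // PersistsUpTo x n}) : Fin n ≃ I.Var f :=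
    .ofBijective x x.2.bijective
  have hinj : Function.Injective toEquiv := fun x x' h => Subtype.ext (congrArg DFunLike.coe h)
  calc (I.persistentVectors f).card
      ≤ Fintype.card {x : Fin n → I.Var f // PersistsUpTo x n} := Finset.card_image_le
    _ ≤ Fintype.card (Fin n ≃ I.Var f) := Fintype.card_le_of_injective toEquiv hinj
    _ = n.factorial := by
      rw [Fintype.card_equiv (Fintype.equivFinOfCardEq (I.card_var f)).symm, Fintype.card_fin]

theorem maxVal_persistentVectors_lt (hconn : I.StronglyConnected) (hfan : I.FanInFree)
    (hpos : I.Positive) {Val : Type*} [LinearOrder Val]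
    {σ : I.Var f → Val} {σ' : I.Var g → Val} (hσ : (I.graph c).Describes σ σ') :
    maxVal (I.persistentVectors g) (persistentVectors_nonempty hfan hpos g) σ' <
      maxVal (I.persistentVectors f) (persistentVectors_nonempty hfan hpos f) σ := by
  classical
  refine (Finset.sup'_lt_iff _).2 fun b hb => ?_
  obtain ⟨⟨y, hy⟩, -, rfl⟩ := Finset.mem_image.1 hb
  obtain ⟨x, hx, hlt⟩ := hy.exists_value_lt hconn hfan hpos hσ
  exact hlt.trans_le (Finset.le_sup' (fun a => a.value σ) hx.toVector_mem)

end Vectors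

end Instance

end SCT

theorem corollary5p4 (n : ℕ) (I : SCT.Instance.{u, v, w} n) (hconn : I.StronglyConnected)
    (hfan : I.FanInFree) (hpos : I.Positive) :
    ∃ (S : ∀ f : I.Point, Finset (SCT.SimpleVector (I.Var f) n (I.numPoints * 2 ^ n * n)))
      (hS : ∀ f, (S f).Nonempty),
      (∀ f, (S f).card ≤ n.factorial) ∧
      ∀ (Val : Type x) [LinearOrder Val] [WellFoundedLT Val],
        I.IsRankingFunction
          (fun s : I.State Val => SCT.maxVal (S s.1) (hS s.1) s.2) :=
  ⟨I.persistentVectors, SCT.Instance.persistentVectors_nonempty hfan hpos,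
    SCT.Instance.card_persistentVectors_le, fun _ _ _ =>
      ⟨wellFounded_lt, fun _ _ ⟨_, hσ⟩ =>
        SCT.Instance.maxVal_persistentVectors_lt hconn hfan hpos hσ⟩⟩
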